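/- Rings are associative with $1$, not necessarily commutative. A skew partial field is a pair $\mathbb{P}=(R,G')$ of a ring $R$ and a subgroup $G'$ of the unit group $R^*$ with $-1\in G'$. Let $E$ be a finite set. An $R$-chain group on $E$ is a left submodule $C$ of $R^E$. A chain $c\in C$ is elementary if $c\neq 0$ and no nonzero chain of $C$ has support strictly contained in the support of $c$. It is $G'$-primitive if all its entries lie in $G'\cup\{0\}$. $C$ is a $\mathbb{P}$-chain group if every elementary $c\in C$ can be written $c=rc'$ with $r\in R$ and $c'\in C$ a $G'$-primitive chain; the supports of the elementary chains are then the cocircuits of a matroid $M(C)$ on $E$. A matroid $M$ is representable over $\mathbb{P}$ if $M=M(C)$ for some $\mathbb{P}$-chain group $C$. Every skew field $\mathbb{F}$ is regarded as the skew partial field $(\mathbb{F},\mathbb{F}^*)$, over which every chain group is a chain group of the skew partial field, and for a matrix $A$ over $\mathbb{F}$ we write $M[A]$ for $M(C)$ with $C$ the left row space of $A$. Let $R_9 := M[A_9]$ be the ternary Reid geometry, where $$A_9=\begin{bmatrix}1&0&0&1&1&1&0&0&1\\0&1&0&1&1&2&1&1&0\\0&0&1&1&0&0&1&2&1\end{bmatrix}\quad\text{over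 } \mathrm{GF}(3).$$ Let $G=\{g_1,\dots,g_8\}=\{1,-1,i,-i,j,-j,k,-k\}$ be the quaternion group, inside the real quaternions $\mathbb{H}$, and let $Q_3(G)$ be the rank-$3$ Dowling geometry of $G$, that is, the matroid $M[I\ A]$ on the $27$ elements $e_1,e_2,e_3,a_1,\dots,a_8,b_1,\dots,b_8,c_1,\dots,c_8$, where $[I\ A]$ is the matrix over $\mathbb{H}$ whose columns $e_1,e_2,e_3$ form the identity matrix, and whose columns $a_n,b_n,c_n$ are $(-1,g_n,0)^T$, $(0,-1,g_n)^T$, $(g_n,0,-1)^T$. Let $R_3:=\mathrm{GF}(3)[i,j,k]$ with $i^2=j^2=k^2=ijk=-1$ be the ring of quaternions over $\mathrm{GF}(3)$. **Theorem.** Let $M:=R_9\oplus Q_3(G)$. 1. $M$ is representable over the skew partial field $(R_3,R_3^*)$. 2. $M$ is not representable over any skew field. 3. If $M$ is representable over a skew partial field $(R,G')$, then $R$ contains $R_3$ as a subring, i.e. there is an injective (unital) ring homomorphism $R_3\to R$. 4. $R_3$ has zero divisors: there are nonzero $x,y\in R_3$ with $xy=0$. -/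

import Mathlib

open Function
open scoped Quaternion

/-- A skew partial field `(R, G)`: a ring `R` (not necessarily commutative) and a subgroup `G` of
the group of units of `R` with `-1 ∈ G`. -/
structure SkewPartialField (R : Type*) [Ring R] where
  group : Subgroup Rˣ
  neg_one_mem : -1 ∈ group

/-- The skew partial field `(R, R^*)`. -/
def SkewPartialField.allUnits (R : Type*) [Ring R] : SkewPartialField R :=
  ⟨⊤, Subgroup.mem_top _⟩

noncomputable section

namespace ChainGroup

section Definitions

variable {R : Type*} [Ring R] {E : Type*}

/-- A chain `c` of the `R`-chain group `C` (a left submodule of `R^E`) is elementary if it is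
nonzero and no nonzero chain of `C` has a support strictly contained in that of `c`. -/
def IsElementary (C : Submodule R (E → R)) (c : E → R) : Prop :=
  c ∈ C ∧ c ≠ 0 ∧ ∀ c' ∈ C, c' ≠ 0 → ¬ support c' ⊂ support c

/-- A chain is `G`-primitive if all its entries lie in `G ∪ {0}`. -/
def IsPrimitive (P : SkewPartialField R) (c : E → R) : Prop :=
  ∀ e, c e = 0 ∨ ∃ g ∈ P.group, c e = (g : R)

/-- `C` is a `P`-chain group, `P = (R, G)`, if every elementary chain `c` of `C` can be written as
`c = r c'` with `c' ∈ C` a `G`-primitive chain and `r ∈ R`. -/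
def IsChainGroup (P : SkewPartialField R) (C : Submodule R (E → R)) : Prop :=
  ∀ c, IsElementary C c → ∃ c' ∈ C, IsPrimitive P c' ∧ ∃ r : R, c = r • c'

/-- A set is coindependent for `C` if it contains the support of no nonzero chain of `C`. -/
def IsCoindep (C : Submodule R (E → R)) (I : Set E) : Prop :=
  ∀ c ∈ C, support c ⊆ I → c = 0

end Definitions

section Matroid

variable {R : Type*} [Ring R] {E : Type*} [Finite E] {P : SkewPartialField R}
  {C : Submodule R (E → R)}

theorem exists_isElementary {c : E → R} (hc : c ∈ C) (h0 : c ≠ 0) :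
    ∃ d, IsElementary C d ∧ support d ⊆ support c := by
  obtain ⟨s, ⟨hs, d, hd, hd0, rfl⟩, hmin⟩ :=
    (Set.toFinite {s : Set E | s ⊆ support c ∧ ∃ d ∈ C, d ≠ 0 ∧ support d = s}).exists_minimal
      ⟨support c, subset_rfl, c, hc, h0, rfl⟩
  refine ⟨d, ⟨hd, hd0, fun c' hc' hc'0 hlt => ?_⟩, hs⟩
  exact hlt.not_subset (hmin ⟨hlt.subset.trans hs, c', hc', hc'0, rfl⟩ hlt.subset)

theorem exists_primitive (h : IsChainGroup P C) {c : E → R} (hc : c ∈ C) (h0 : c ≠ 0) :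
    ∃ d ∈ C, d ≠ 0 ∧ IsPrimitive P d ∧ support d ⊆ support c := by
  obtain ⟨d, hd, hdc⟩ := exists_isElementary hc h0
  obtain ⟨c', hc', hp, r, rfl⟩ := h d hd
  have hr : r ≠ 0 := by rintro rfl; exact hd.2.1 (zero_smul _ _)
  refine ⟨c', hc', ?_, hp, fun e he => hdc ?_⟩
  · rintro rfl; exact hd.2.1 (smul_zero _)
  · rcases hp e with h1 | ⟨g, -, hg⟩
    · exact absurd h1 he
    · intro h2
      apply hr
      have h3 : r * (g : R) = 0 := by simpa [hg] using h2
      simpa using congrArg (· * ((g⁻¹ : Rˣ) : R)) h3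

theorem elimination {E : Type*} {C : Submodule R (E → R)} {c d : E → R} (hc : c ∈ C) (hd : d ∈ C)
    (hcp : IsPrimitive P c) (hdp : IsPrimitive P d) (hne : support c ≠ support d)
    {e : E} (hec : e ∈ support c) (hed : e ∈ support d) :
    ∃ b ∈ C, b ≠ 0 ∧ support b ⊆ (support c ∪ support d) \ {e} := by
  obtain ⟨g, -, hg⟩ := (hcp e).resolve_left hec
  obtain ⟨k, -, hk⟩ := (hdp e).resolve_left hed
  refine ⟨((k⁻¹ : Rˣ) : R) • d - ((g⁻¹ : Rˣ) : R) • c,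
    C.sub_mem (C.smul_mem _ hd) (C.smul_mem _ hc), fun h0 => hne ?_, fun f hf => ⟨?_, ?_⟩⟩
  · ext f
    have hf : ((k⁻¹ : Rˣ) : R) * d f = ((g⁻¹ : Rˣ) : R) * c f := by
      simpa [sub_eq_zero] using congrFun h0 f
    rw [mem_support, mem_support, not_iff_not, ← Units.mul_right_eq_zero g⁻¹, ← hf,
      Units.mul_right_eq_zero]
  · by_contra hcon
    simp only [Set.mem_union, mem_support, not_or, not_not] at hcon
    exact hf (by simp [hcon.1, hcon.2])
  · rintro rfl
    exact hf (by simp [hg, hk])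

theorem isCoindep_empty {E : Type*} (C : Submodule R (E → R)) : IsCoindep C ∅ :=
  fun _ _ hcs => support_eq_empty_iff.1 (Set.subset_empty_iff.1 hcs)

theorem IsCoindep.subset {E : Type*} {C : Submodule R (E → R)} {I J : Set E}
    (hJ : IsCoindep C J) (hIJ : I ⊆ J) : IsCoindep C I :=
  fun c hc hcs => hJ c hc (hcs.trans hIJ)

theorem isCoindep_augment (h : IsChainGroup P C) {I J : Set E} (hI : IsCoindep C I)
    (hJ : IsCoindep C J) (hIJ : I.ncard < J.ncard) :
    ∃ e ∈ J, e ∉ I ∧ IsCoindep C (insert e I) := by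
  by_contra! hcon
  obtain ⟨K, ⟨hK, hKIJ, hIK⟩, hmin⟩ :=
    Set.exists_min_image {K : Set E | IsCoindep C K ∧ K ⊆ I ∪ J ∧ I.ncard < K.ncard}
      (fun K => (I \ K).ncard) (Set.toFinite _) ⟨J, hJ, Set.subset_union_right, hIJ⟩
  have hnot : ¬ I ⊆ K := by
    intro hsub
    obtain ⟨f, hfK, hfI⟩ := Set.exists_mem_notMem_of_ncard_lt_ncard hIK
    refine hcon f ((hKIJ hfK).resolve_left hfI) hfI fun c hc hcs => hK c hc (hcs.trans ?_)
    exact Set.insert_subset hfK hsub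
  obtain ⟨e, heI, heK⟩ := Set.not_subset.1 hnot
  have key : ∀ f ∈ K \ I, ∃ c ∈ C, IsPrimitive P c ∧ c ≠ 0 ∧ support c ⊆ insert e K \ {f} ∧
      e ∈ support c := by
    intro f hf
    have hef : e ≠ f := by rintro rfl; exact hf.2 heI
    have hT : ¬ IsCoindep C (insert e K \ {f}) := by
      intro hT
      have hcard : (insert e K \ {f}).ncard = K.ncard := by
        rw [Set.ncard_sdiff_singleton_of_mem (Set.mem_insert_of_mem _ hf.1),
          Set.ncard_insert_of_notMem heK]
        rfl
      have h1 := hmin (insert e K \ {f}) ⟨hT, fun x hx => ?_, hcard ▸ hIK⟩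
      · refine absurd h1 (not_le.2 (Set.ncard_lt_ncard ?_))
        refine ⟨fun x hx => ⟨hx.1, fun hxK => hx.2 ⟨Set.mem_insert_of_mem _ hxK, ?_⟩⟩, ?_⟩
        · rintro rfl; exact hf.2 hx.1
        · intro hsub
          exact (hsub ⟨heI, heK⟩).2 ⟨Set.mem_insert _ _, hef⟩
      · rcases hx.1 with rfl | hxK
        · exact Or.inl heI
        · exact hKIJ hxK
    simp only [IsCoindep, not_forall] at hT
    obtain ⟨c, hc, hcs, hc0⟩ := hT
    obtain ⟨d, hd, hd0, hdp, hdc⟩ := exists_primitive h hc hc0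
    refine ⟨d, hd, hdp, hd0, hdc.trans hcs, ?_⟩
    by_contra hed
    refine hd0 (hK d hd fun x hx => ?_)
    rcases (hcs (hdc hx)).1 with rfl | hxK
    · exact absurd hx hed
    · exact hxK
  obtain ⟨f, hfK, hfI⟩ := Set.exists_mem_notMem_of_ncard_lt_ncard hIK
  obtain ⟨c, hc, hcp, hc0, hcs, hec⟩ := key f ⟨hfK, hfI⟩
  have hex : ∃ k ∈ support c, k ∉ I := by
    by_contra! hall
    exact hc0 (hI c hc hall)
  obtain ⟨k, hkc, hkI⟩ := hex
  have hkK : k ∈ K := by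
    rcases (hcs hkc).1 with rfl | hkK
    · exact absurd heI hkI
    · exact hkK
  obtain ⟨d, hd, hdp, -, hds, hed⟩ := key k ⟨hkK, hkI⟩
  have hne : support c ≠ support d := by
    intro heq
    exact (hds (heq ▸ hkc)).2 rfl
  obtain ⟨b, hb, hb0, hbs⟩ := elimination hc hd hcp hdp hne hec hed
  refine hb0 (hK b hb fun x hx => ?_)
  obtain ⟨hx1, hx2⟩ := hbs hx
  have : x ∈ insert e K := by
    rcases hx1 with hx1 | hx1
    · exact (hcs hx1).1
    · exact (hds hx1).1
  exact this.resolve_left hx2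

/-- The matroid `M(C)` on `E` of a `P`-chain group `C`: the cocircuits are the supports of the
elementary chains of `C` (see `isCocircuit_matroid_iff`). -/
def matroid (P : SkewPartialField R) (C : Submodule R (E → R)) (h : IsChainGroup P C) :
    Matroid E :=
  (IndepMatroid.ofFinite (E := Set.univ) Set.finite_univ (IsCoindep C)
    (isCoindep_empty C) (fun _ _ hJ hIJ => hJ.subset hIJ)
    (fun _ _ hI hJ hIJ => isCoindep_augment h hI hJ hIJ)
    (fun _ _ => Set.subset_univ _)).matroid✶

theorem isCocircuit_matroid_iff (h : IsChainGroup P C) (X : Set E) :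
    (matroid P C h).IsCocircuit X ↔ ∃ c, IsElementary C c ∧ support c = X := by
  have hdep : ∀ Y : Set E, (matroid P C h)✶.Dep Y ↔ ∃ c ∈ C, c ≠ 0 ∧ support c ⊆ Y := by
    intro Y
    have hind : (matroid P C h)✶.Indep Y ↔ IsCoindep C Y := by
      rw [matroid, Matroid.dual_dual, IndepMatroid.matroid_Indep, IndepMatroid.ofFinite_indep]
    have hE : (matroid P C h)✶.E = Set.univ := rfl
    simp only [Matroid.Dep, hind, hE, Set.subset_univ, and_true, IsCoindep, not_forall]
    exact ⟨fun ⟨c, h1, h2, h3⟩ => ⟨c, h1, h3, h2⟩, fun ⟨c, h1, h2, h3⟩ => ⟨c, h1, h3, h2⟩⟩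
  rw [Matroid.isCocircuit_def, Matroid.isCircuit_def]
  constructor
  · rintro ⟨hX, hmin⟩
    obtain ⟨c, hc, hc0, hcX⟩ := (hdep X).1 hX
    obtain ⟨d, hd, hdc⟩ := exists_isElementary hc hc0
    have hdX := hdc.trans hcX
    exact ⟨d, hd, hdX.antisymm (hmin ((hdep _).2 ⟨d, hd.1, hd.2.1, subset_rfl⟩) hdX)⟩
  · rintro ⟨c, hc, rfl⟩
    refine ⟨(hdep _).2 ⟨c, hc.1, hc.2.1, subset_rfl⟩, fun Y hY hYc => ?_⟩
    obtain ⟨d, hd, hd0, hdY⟩ := (hdep Y).1 hY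
    by_contra hlt
    exact hc.2.2 d hd hd0 ⟨hdY.trans hYc, fun hcd => hlt (hcd.trans hdY)⟩

/-- A matroid `M` on the finite set `E` is `P`-representable if `M = M(C)` for some `P`-chain
group `C` on `E`. -/
def IsRepresentable (P : SkewPartialField R) (M : Matroid E) : Prop :=
  ∃ (C : Submodule R (E → R)) (h : IsChainGroup P C), M = matroid P C h

end Matroid

section SkewField

variable {D : Type*} [DivisionRing D] {E : Type*}

/-- Over a skew field `D`, every chain group is a `(D, D^*)`-chain group. -/
theorem isChainGroup_allUnits (C : Submodule D (E → D)) :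
    IsChainGroup (SkewPartialField.allUnits D) C := by
  refine fun c hc => ⟨c, hc.1, fun e => ?_, 1, (one_smul _ _).symm⟩
  by_cases he : c e = 0
  · exact Or.inl he
  · exact Or.inr ⟨Units.mk0 _ he, Subgroup.mem_top _, rfl⟩

/-- The matroid `M[A]` of a matrix `A` over a skew field: the matroid of the chain group spanned
by the rows of `A` (as a left vector space). -/
def matrixMatroid {X : Type*} [Finite E] (A : Matrix X E D) : Matroid E :=
  matroid (SkewPartialField.allUnits D) (Submodule.span D (Set.range A.row))
    (isChainGroup_allUnits _)

end SkewField

/-- The ternary Reid geometry `R_9`. -/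
def R9 : Matroid (Fin 9) :=
  matrixMatroid (!![1, 0, 0, 1, 1, 1, 0, 0, 1;
                    0, 1, 0, 1, 1, 2, 1, 1, 0;
                    0, 0, 1, 1, 0, 0, 1, 2, 1] : Matrix (Fin 3) (Fin 9) (ZMod 3))

/-- The elements `1, -1, i, -i, j, -j, k, -k` of the quaternion group `G`, inside the (skew field
of) real quaternions. -/
def quaternionGroupElt : Fin 8 → ℍ[ℝ] :=
  ![1, -1, ⟨0, 1, 0, 0⟩, ⟨0, -1, 0, 0⟩, ⟨0, 0, 1, 0⟩, ⟨0, 0, -1, 0⟩, ⟨0, 0, 0, 1⟩, ⟨0, 0, 0, -1⟩]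

/-- The columns of the matrix `[I A]` over the real quaternions that represents `Q_3(G)`. The four
summands index `e_1, e_2, e_3`, then `a_1, ..., a_8`, then `b_1, ..., b_8`, then
`c_1, ..., c_8`. -/
def Q3Column : Fin 3 ⊕ Fin 8 ⊕ Fin 8 ⊕ Fin 8 → Fin 3 → ℍ[ℝ] :=
  Sum.elim (fun n => Pi.single n 1) <|
  Sum.elim (fun n => ![-1, quaternionGroupElt n, 0]) <|
  Sum.elim (fun n => ![0, -1, quaternionGroupElt n])
    (fun n => ![quaternionGroupElt n, 0, -1])

/-- The rank-3 Dowling geometry `Q_3(G)` of the quaternion group `G`. -/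
def Q3 : Matroid (Fin 3 ⊕ Fin 8 ⊕ Fin 8 ⊕ Fin 8) :=
  matrixMatroid (Matrix.of fun x y => Q3Column y x)

end ChainGroup

end

/-- The ring `R_3 = GF(3)[i, j, k]` with `i² = j² = k² = ijk = -1`: the Hamilton quaternions over
the field with three elements. -/
abbrev QuaternionsMod3 : Type := ℍ[ZMod 3]

/-! Everything is phrased through coindependent sets, the independent sets of the dual matroid, by
`isRepresentable_iff`. In this language representations of two matroids combine to one of their
direct sum, and a representation of the sum gives one of each summand, so `R9` and `Q3` can be
treated separately.

Existence: `R9` is defined over GF(3), and extending scalars to a nonzero algebra keeps its matroid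
(`isRepresentable_matrixMatroid_algebra`). For `Q3` all that matters is a copy of the quaternion
group whose distinct elements differ by units. Such differences have norm 2 or 4, so the quaternions
over any ring with 2 invertible will do (`isRepresentable_Q3_quaternion`).

Necessity: `exists_basis_chains` gives a representing chain group the shape of the matrix, with
units in place of nonzero entries and a combination of rows for each cocircuit used. Solving these
relations for `R9` forces 3 = 0; for `Q3` it produces a copy of the quaternion group with unit
differences (`exists_isQuaternionFamily_of_isRepresentable_Q3`). Together they give a homomorphism
from R_3 to R. It is injective because every nonzero two-sided ideal of R_3 contains a nonzero
scalar. As R_3 has zero divisors, no skew field can contain it. -/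

namespace ChainGroup

/-! ### Direct sums of chain groups and passage to summands -/

section Sums

variable {R : Type*} [Ring R] {E F : Type*}

theorem matroid_dual_indep_iff [Finite E] {P : SkewPartialField R} {C : Submodule R (E → R)}
    (h : IsChainGroup P C) (I : Set E) : (matroid P C h)✶.Indep I ↔ IsCoindep C I := by
  rw [matroid, Matroid.dual_dual, IndepMatroid.matroid_Indep, IndepMatroid.ofFinite_indep]

/-- A matroid is determined by its dual, so comparing coindependent sets is enough; elementary
chains need never be classified. -/
theorem isRepresentable_iff [Finite E] {P : SkewPartialField R} {M : Matroid E} :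
    IsRepresentable P M ↔ ∃ C : Submodule R (E → R), IsChainGroup P C ∧ M.E = Set.univ ∧
      ∀ I, M✶.Indep I ↔ IsCoindep C I := by
  constructor
  · rintro ⟨C, h, rfl⟩
    exact ⟨C, h, rfl, matroid_dual_indep_iff h⟩
  · rintro ⟨C, h, hE, hI⟩
    refine ⟨C, h, Matroid.dual_inj.1 (Matroid.ext_indep hE fun I _ => ?_)⟩
    rw [hI, matroid_dual_indep_iff]

/-- Converse of `exists_primitive`. -/
theorem isChainGroup_of_exists_primitive {P : SkewPartialField R} {C : Submodule R (E → R)}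
    (h : ∀ c ∈ C, c ≠ 0 → ∃ d ∈ C, d ≠ 0 ∧ IsPrimitive P d ∧ support d ⊆ support c) :
    IsChainGroup P C := by
  intro c hc
  obtain ⟨d, hd, hd0, hdp, hdc⟩ := h c hc.1 hc.2.1
  obtain ⟨e, he⟩ := Function.ne_iff.1 hd0
  obtain ⟨g, -, hg⟩ := (hdp e).resolve_left he
  -- This multiple of `d` agrees with `c` at `e`, so the difference has support strictly inside that
  -- of `c` and vanishes by minimality.
  refine ⟨d, hd, hdp, c e * ((g⁻¹ : Rˣ) : R), ?_⟩
  by_contra hne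
  refine hc.2.2 _ (C.sub_mem hc.1 (C.smul_mem (c e * ((g⁻¹ : Rˣ) : R)) hd)) (sub_ne_zero.2 hne)
    ⟨fun x hx => ?_, fun hsub => ?_⟩
  · by_contra hcx
    have hdx : d x = 0 := by
      by_contra hdx
      exact hcx (hdc hdx)
    rw [notMem_support] at hcx
    exact hx (by simp [hcx, hdx])
  · exact hsub (hdc he) (by simp [hg])

theorem sum_dual (M : Matroid E) (N : Matroid F) : (M.sum N)✶ = M✶.sum N✶ := by
  refine Matroid.ext_isBase (by simp) fun B hB => ?_
  have hB' : B ⊆ (M.sum N).E := hB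
  rw [Matroid.sum_ground] at hB'
  have h1 : Sum.inl ⁻¹' B ⊆ M.E := fun x hx => by simpa using hB' hx
  have h2 : Sum.inr ⁻¹' B ⊆ N.E := fun x hx => by simpa using hB' hx
  rw [Matroid.dual_isBase_iff, Matroid.sum_isBase_iff, Matroid.sum_isBase_iff,
    Matroid.dual_isBase_iff, Matroid.dual_isBase_iff]
  have h3 : Sum.inl ⁻¹' ((M.sum N).E \ B) = M.E \ Sum.inl ⁻¹' B := by ext; simp
  have h4 : Sum.inr ⁻¹' ((M.sum N).E \ B) = N.E \ Sum.inr ⁻¹' B := by ext; simp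
  rw [h3, h4]

theorem sum_ground_eq_univ {M : Matroid E} {N : Matroid F} :
    (M.sum N).E = Set.univ ↔ M.E = Set.univ ∧ N.E = Set.univ := by
  simp [Set.eq_univ_iff_forall]

/-- The direct sum of two chain groups. -/
def directSum (C : Submodule R (E → R)) (D : Submodule R (F → R)) : Submodule R (E ⊕ F → R) :=
  C.comap (LinearMap.funLeft R R Sum.inl) ⊓ D.comap (LinearMap.funLeft R R Sum.inr)

theorem mem_directSum {C : Submodule R (E → R)} {D : Submodule R (F → R)} {c : E ⊕ F → R} :
    c ∈ directSum C D ↔ c ∘ Sum.inl ∈ C ∧ c ∘ Sum.inr ∈ D := Iff.rfl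

theorem isCoindep_directSum {C : Submodule R (E → R)} {D : Submodule R (F → R)}
    {I : Set (E ⊕ F)} :
    IsCoindep (directSum C D) I ↔
      IsCoindep C (Sum.inl ⁻¹' I) ∧ IsCoindep D (Sum.inr ⁻¹' I) := by
  refine ⟨fun h => ⟨fun c hc hcs => ?_, fun d hd hds => ?_⟩, fun ⟨h1, h2⟩ c hc hcs => ?_⟩
  · have := h (Sum.elim c 0) (mem_directSum.2 ⟨hc, D.zero_mem⟩) (by
      rintro (x | x) hx
      · exact hcs hx
      · simp at hx)
    funext x
    exact congrFun this (Sum.inl x)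
  · have := h (Sum.elim 0 d) (mem_directSum.2 ⟨C.zero_mem, hd⟩) (by
      rintro (x | x) hx
      · simp at hx
      · exact hds hx)
    funext x
    exact congrFun this (Sum.inr x)
  · have hl := h1 _ hc.1 fun x hx => hcs hx
    have hr := h2 _ hc.2 fun x hx => hcs hx
    funext x
    rcases x with x | x
    · exact congrFun hl x
    · exact congrFun hr x

/-- A nonzero chain is nonzero on one of the two sides; a primitive chain below that side, extended
by zero, lies below the whole chain. -/
theorem IsChainGroup.directSum {P : SkewPartialField R} {C : Submodule R (E → R)}
    {D : Submodule R (F → R)} [Finite E] [Finite F]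
    (hC : IsChainGroup P C) (hD : IsChainGroup P D) : IsChainGroup P (directSum C D) := by
  refine isChainGroup_of_exists_primitive fun c hc hc0 => ?_
  by_cases hl : c ∘ Sum.inl = 0
  · have hr : c ∘ Sum.inr ≠ 0 := fun hr => hc0 (by
      funext x
      rcases x with x | x
      · exact congrFun hl x
      · exact congrFun hr x)
    obtain ⟨d, hd, hd0, hdp, hds⟩ := exists_primitive hD hc.2 hr
    refine ⟨Sum.elim 0 d, mem_directSum.2 ⟨C.zero_mem, hd⟩, fun h => hd0 ?_, ?_, ?_⟩
    · funext x
      exact congrFun h (Sum.inr x)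
    · rintro (x | x)
      · exact Or.inl rfl
      · exact hdp x
    · rintro (x | x) hx
      · simp at hx
      · exact hds hx
  · obtain ⟨d, hd, hd0, hdp, hds⟩ := exists_primitive hC hc.1 hl
    refine ⟨Sum.elim d 0, mem_directSum.2 ⟨hd, D.zero_mem⟩, fun h => hd0 ?_, ?_, ?_⟩
    · funext x
      exact congrFun h (Sum.inl x)
    · rintro (x | x)
      · exact hdp x
      · exact Or.inl rfl
    · rintro (x | x) hx
      · exact hds hx
      · simp at hx

theorem IsRepresentable.sum [Finite E] [Finite F] {P : SkewPartialField R} {M : Matroid E}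
    {N : Matroid F} (hM : IsRepresentable P M) (hN : IsRepresentable P N) :
    IsRepresentable P (M.sum N) := by
  obtain ⟨C, hC, hME, hCI⟩ := isRepresentable_iff.1 hM
  obtain ⟨D, hD, hNE, hDI⟩ := isRepresentable_iff.1 hN
  refine isRepresentable_iff.2 ⟨ChainGroup.directSum C D, hC.directSum hD,
    sum_ground_eq_univ.2 ⟨hME, hNE⟩, fun I => ?_⟩
  rw [sum_dual, Matroid.sum_indep_iff, hCI, hDI, isCoindep_directSum]

/-- The chains on `E` whose extension by zero along `f : E → F` belongs to a chain group. -/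
def contractTo (f : E → F) (hf : Injective f) (C : Submodule R (F → R)) : Submodule R (E → R) where
  carrier := {c | extend f c 0 ∈ C}
  zero_mem' := by
    have : extend f (0 : E → R) (0 : F → R) = 0 := by
      funext x
      by_cases hx : ∃ a, f a = x
      · obtain ⟨a, rfl⟩ := hx
        simp [hf.extend_apply]
      · simp [extend_apply' _ _ _ hx]
    simp only [Set.mem_ofPred_eq, this, C.zero_mem]
  add_mem' := fun {c d} hc hd => by
    have : extend f (c + d) (0 : F → R) = extend f c 0 + extend f d 0 := by
      rw [← extend_add, add_zero]
    simpa only [Set.mem_ofPred_eq, this] using C.add_mem hc hd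
  smul_mem' := fun r c hc => by
    have : extend f (r • c) (0 : F → R) = r • extend f c 0 := by
      rw [← extend_smul, smul_zero]
    simpa only [Set.mem_ofPred_eq, this] using C.smul_mem r hc

theorem support_extend_zero {f : E → F} (hf : Injective f) (c : E → R) :
    support (extend f c (0 : F → R)) = f '' support c := by
  ext x
  by_cases hx : ∃ a, f a = x
  · obtain ⟨a, rfl⟩ := hx
    simp [hf.extend_apply, hf.mem_set_image]
  · rw [mem_support, extend_apply' _ _ _ hx]
    simp only [Pi.zero_apply, ne_eq, not_true_eq_false, false_iff]
    rintro ⟨a, -, ha⟩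
    exact hx ⟨a, ha⟩

theorem exists_extend_eq {f : E → F} (hf : Injective f) {c : F → R}
    (hc : support c ⊆ Set.range f) : c = extend f (c ∘ f) 0 := by
  funext x
  by_cases hx : ∃ a, f a = x
  · obtain ⟨a, rfl⟩ := hx
    simp [hf.extend_apply]
  · rw [extend_apply' _ _ _ hx]
    by_contra h
    exact hx (hc h)

theorem extend_zero_eq_zero {f : E → F} (hf : Injective f) {c : E → R} :
    extend f c (0 : F → R) = 0 ↔ c = 0 := by
  rw [← support_eq_empty_iff, support_extend_zero hf, Set.image_eq_empty, support_eq_empty_iff]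

theorem isCoindep_contractTo {f : E → F} (hf : Injective f) {C : Submodule R (F → R)}
    {I : Set E} : IsCoindep (contractTo f hf C) I ↔ IsCoindep C (f '' I) := by
  refine ⟨fun h c hc hcs => ?_, fun h c hc hcs => ?_⟩
  · have hce := exists_extend_eq hf (hcs.trans (Set.image_subset_range _ _))
    have h0 := h (c ∘ f) (by rw [hce] at hc; exact hc) fun x hx => by
      obtain ⟨y, hy, hyx⟩ := hcs (show f x ∈ support c from hx)
      exact hf hyx ▸ hy
    rw [hce, (extend_zero_eq_zero hf).2 h0]
  · exact (extend_zero_eq_zero hf).1 (h _ hc (by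
      rw [support_extend_zero hf]
      exact Set.image_mono hcs))

/-- A primitive chain below an extended chain is itself supported on the range of `f`, hence pulls
back to `E`. -/
theorem IsChainGroup.contractTo [Finite F] {P : SkewPartialField R} {f : E → F}
    (hf : Injective f) {C : Submodule R (F → R)} (hC : IsChainGroup P C) :
    IsChainGroup P (contractTo f hf C) := by
  refine isChainGroup_of_exists_primitive fun c hc hc0 => ?_
  obtain ⟨d, hd, hd0, hdp, hds⟩ :=
    exists_primitive hC hc (mt (extend_zero_eq_zero hf).1 hc0)
  rw [support_extend_zero hf] at hds
  have hde := exists_extend_eq hf (hds.trans (Set.image_subset_range _ _))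
  refine ⟨d ∘ f, by rw [hde] at hd; exact hd, fun h0 => hd0 ?_, fun x => hdp (f x), fun x hx => ?_⟩
  · rw [hde, (extend_zero_eq_zero hf).2 h0]
  · obtain ⟨y, hy, hyx⟩ := hds (show f x ∈ support d from hx)
    exact hf hyx ▸ hy

theorem IsRepresentable.of_sum_left [Finite E] [Finite F] {P : SkewPartialField R}
    {M : Matroid E} {N : Matroid F} (h : IsRepresentable P (M.sum N)) : IsRepresentable P M := by
  obtain ⟨C, hC, hE, hCI⟩ := isRepresentable_iff.1 h
  refine isRepresentable_iff.2 ⟨ChainGroup.contractTo Sum.inl Sum.inl_injective C,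
    hC.contractTo _, (sum_ground_eq_univ.1 hE).1, fun I => ?_⟩
  rw [isCoindep_contractTo, ← hCI, sum_dual, Matroid.sum_indep_iff,
    Set.preimage_image_eq _ Sum.inl_injective, Set.preimage_inr_image_inl]
  simp

theorem IsRepresentable.of_sum_right [Finite E] [Finite F] {P : SkewPartialField R}
    {M : Matroid E} {N : Matroid F} (h : IsRepresentable P (M.sum N)) : IsRepresentable P N := by
  obtain ⟨C, hC, hE, hCI⟩ := isRepresentable_iff.1 h
  refine isRepresentable_iff.2 ⟨ChainGroup.contractTo Sum.inr Sum.inr_injective C,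
    hC.contractTo _, (sum_ground_eq_univ.1 hE).2, fun I => ?_⟩
  rw [isCoindep_contractTo, ← hCI, sum_dual, Matroid.sum_indep_iff,
    Set.preimage_image_eq _ Sum.inr_injective, Set.preimage_inl_image_inr]
  simp

end Sums

/-! ### Comparing chain groups through matrices -/

section Matrices

variable {R : Type*} [Ring R] {X E : Type*} [Fintype X]

theorem mem_span_row_iff {A : Matrix X E R} {c : E → R} :
    c ∈ Submodule.span R (Set.range A.row) ↔ ∃ u : X → R, Matrix.vecMul u A = c := by
  rw [← range_vecMulLinear]
  rfl

/-- Coindependence passes from `B` to `A` (matrices over possibly different rings) if the support of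
each nonzero row combination of `A` contains that of a nonzero row combination of `B`. -/
theorem isCoindep_span_row_of_transfer {S : Type*} [Ring S] {Y : Type*} [Fintype Y]
    {A : Matrix X E R} {B : Matrix Y E S}
    (h : ∀ u, Matrix.vecMul u A ≠ 0 → ∃ v, Matrix.vecMul v B ≠ 0 ∧
      support (Matrix.vecMul v B) ⊆ support (Matrix.vecMul u A)) {I : Set E}
    (hI : IsCoindep (Submodule.span S (Set.range B.row)) I) :
    IsCoindep (Submodule.span R (Set.range A.row)) I := by
  intro c hc hcs
  obtain ⟨u, rfl⟩ := mem_span_row_iff.1 hc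
  by_contra hne
  obtain ⟨v, hv, hvs⟩ := h u hne
  exact hv (hI _ (mem_span_row_iff.2 ⟨v, rfl⟩) (hvs.trans hcs))

/-- A matroid represented by a matrix `A` over a skew field is representable over `(R, R^*)` if
there is a matrix `B` over `R` with the same minimal supports of row combinations, attained by
combinations with entries in `R^* ∪ {0}`. -/
theorem isRepresentable_matrixMatroid_of_transfer [Finite E] {D : Type*} [DivisionRing D]
    {Y : Type*} [Fintype Y] {A : Matrix X E D} {B : Matrix Y E R}
    (hAB : ∀ u, Matrix.vecMul u A ≠ 0 → ∃ v, Matrix.vecMul v B ≠ 0 ∧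
      support (Matrix.vecMul v B) ⊆ support (Matrix.vecMul u A))
    (hBA : ∀ u, Matrix.vecMul u B ≠ 0 → ∃ v, Matrix.vecMul v A ≠ 0 ∧
      support (Matrix.vecMul v A) ⊆ support (Matrix.vecMul u B))
    (hBB : ∀ u, Matrix.vecMul u B ≠ 0 → ∃ v, Matrix.vecMul v B ≠ 0 ∧
      (∀ e, Matrix.vecMul v B e = 0 ∨ IsUnit (Matrix.vecMul v B e)) ∧
      support (Matrix.vecMul v B) ⊆ support (Matrix.vecMul u B)) :
    IsRepresentable (SkewPartialField.allUnits R) (matrixMatroid A) := by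
  refine isRepresentable_iff.2 ⟨Submodule.span R (Set.range B.row), ?_, rfl, fun I => ?_⟩
  · refine isChainGroup_of_exists_primitive fun c hc hc0 => ?_
    obtain ⟨u, rfl⟩ := mem_span_row_iff.1 hc
    obtain ⟨v, hv0, hvu, hvs⟩ := hBB u hc0
    refine ⟨_, mem_span_row_iff.2 ⟨v, rfl⟩, hv0, fun e => (hvu e).imp_right ?_, hvs⟩
    rintro ⟨g, hg⟩
    exact ⟨g, Subgroup.mem_top _, hg.symm⟩
  · rw [matrixMatroid, matroid_dual_indep_iff]
    exact ⟨isCoindep_span_row_of_transfer hBA, isCoindep_span_row_of_transfer hAB⟩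

/-- A chain group representing the matroid of a matrix `A` contains, for each row combination of
`A`, a nonzero chain with unit entries on a subset of its support. -/
theorem exists_chain_of_vecMul [Finite E] {P : SkewPartialField R} {C : Submodule R (E → R)}
    (hC : IsChainGroup P C) {D : Type*} [DivisionRing D] {A : Matrix X E D}
    (hCI : ∀ I, IsCoindep (Submodule.span D (Set.range A.row)) I ↔ IsCoindep C I)
    (u : X → D) (hu : Matrix.vecMul u A ≠ 0) :
    ∃ c ∈ C, c ≠ 0 ∧ (∀ e, c e = 0 ∨ IsUnit (c e)) ∧
      ∀ e, Matrix.vecMul u A e = 0 → c e = 0 := by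
  have h : ¬ IsCoindep C (support (Matrix.vecMul u A)) := fun h =>
    hu ((hCI _).2 h _ (mem_span_row_iff.2 ⟨u, rfl⟩) subset_rfl)
  simp only [IsCoindep, not_forall] at h
  obtain ⟨c, hc, hcs, hc0⟩ := h
  obtain ⟨d, hd, hd0, hdp, hds⟩ := exists_primitive hC hc hc0
  refine ⟨d, hd, hd0, fun e => (hdp e).imp_right ?_, fun e he => ?_⟩
  · rintro ⟨g, -, hg⟩
    exact hg ▸ g.isUnit
  · by_contra hde
    exact hcs (hds hde) he

/-- A chain is zero if the only row combination of the represented matrix that vanishes wherever the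
chain does is zero. -/
theorem eq_zero_of_forall_vecMul {C : Submodule R (E → R)} {D : Type*} [DivisionRing D]
    {A : Matrix X E D}
    (hCI : ∀ I, IsCoindep (Submodule.span D (Set.range A.row)) I ↔ IsCoindep C I) {c : E → R}
    (hc : c ∈ C) (h : ∀ v, (∀ e, c e = 0 → Matrix.vecMul v A e = 0) → Matrix.vecMul v A = 0) :
    c = 0 := by
  refine (hCI (support c)).1 (fun d hd hds => ?_) c hc subset_rfl
  obtain ⟨v, rfl⟩ := mem_span_row_iff.1 hd
  refine h v fun e he => ?_
  by_contra hve
  exact hds hve he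

end Matrices

end ChainGroup

namespace ChainGroup

/-! ### Extension of scalars -/

section Reid

/-- The matrix of the ternary Reid geometry. -/
def reidMatrix : Matrix (Fin 3) (Fin 9) (ZMod 3) :=
  !![1, 0, 0, 1, 1, 1, 0, 0, 1;
     0, 1, 0, 1, 1, 2, 1, 1, 0;
     0, 0, 1, 1, 0, 0, 1, 2, 1]

theorem vecMul_ne_zero_iff {X E R : Type*} [Fintype X] [Ring R] {A : Matrix X E R} {u : X → R} :
    Matrix.vecMul u A ≠ 0 ↔ ∃ e, Matrix.vecMul u A e ≠ 0 := Function.ne_iff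

/-- A matroid represented over a field `K` is representable over every nonzero `K`-algebra. -/
theorem isRepresentable_matrixMatroid_algebra {K R X E : Type*} [Field K] [Ring R] [Algebra K R]
    [Nontrivial R] [Finite E] [Fintype X] (A : Matrix X E K) :
    IsRepresentable (SkewPartialField.allUnits R) (matrixMatroid A) := by
  have hmap : ∀ (u : X → K) e, Matrix.vecMul (fun x => algebraMap K R (u x))
      (A.map (algebraMap K R)) e = algebraMap K R (Matrix.vecMul u A e) := by
    intro u e
    simp [Matrix.vecMul, dotProduct, map_sum]
  have hup : ∀ u : X → K, Matrix.vecMul u A ≠ 0 → ∃ v : X → R,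
      Matrix.vecMul v (A.map (algebraMap K R)) ≠ 0 ∧
      (∀ e, Matrix.vecMul v (A.map (algebraMap K R)) e = 0 ∨
        IsUnit (Matrix.vecMul v (A.map (algebraMap K R)) e)) ∧
      support (Matrix.vecMul v (A.map (algebraMap K R))) ⊆ support (Matrix.vecMul u A) := by
    intro u hu
    refine ⟨fun x => algebraMap K R (u x), ?_, fun e => ?_, fun e he => ?_⟩
    · obtain ⟨e, he⟩ := vecMul_ne_zero_iff.1 hu
      refine vecMul_ne_zero_iff.2 ⟨e, ?_⟩
      rw [hmap]
      simpa using he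
    · rw [hmap]
      by_cases h0 : Matrix.vecMul u A e = 0
      · exact Or.inl (by simp [h0])
      · exact Or.inr ((IsUnit.mk0 _ h0).map (algebraMap K R))
    · rw [mem_support, hmap] at he
      intro h0
      exact he (by simp [h0])
  have hdown : ∀ u : X → R, Matrix.vecMul u (A.map (algebraMap K R)) ≠ 0 → ∃ v : X → K,
      Matrix.vecMul v A ≠ 0 ∧
      support (Matrix.vecMul v A) ⊆ support (Matrix.vecMul u (A.map (algebraMap K R))) := by
    intro u hu
    obtain ⟨e, he⟩ := vecMul_ne_zero_iff.1 hu
    -- A `K`-linear functional commutes with combinations of the rows of `A`, whose entries are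
    -- scalars, so it can only shrink supports; choosing it nonzero at one entry keeps the result
    -- nonzero.
    obtain ⟨φ, hφ⟩ : ∃ φ : Module.Dual K R, φ (Matrix.vecMul u (A.map (algebraMap K R)) e) ≠ 0 := by
      by_contra! h
      exact he ((Module.forall_dual_apply_eq_zero_iff K _).1 h)
    have hφmap : ∀ e, Matrix.vecMul (fun x => φ (u x)) A e =
        φ (Matrix.vecMul u (A.map (algebraMap K R)) e) := by
      intro e
      simp only [Matrix.vecMul, dotProduct, Matrix.map_apply, map_sum]
      refine Finset.sum_congr rfl fun x _ => ?_
      rw [← Algebra.commutes, ← Algebra.smul_def, map_smul, smul_eq_mul, mul_comm]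
    refine ⟨fun x => φ (u x), vecMul_ne_zero_iff.2 ⟨e, by rwa [hφmap]⟩, fun e he => ?_⟩
    rw [mem_support, hφmap] at he
    intro h0
    exact he (by rw [h0, map_zero])
  refine isRepresentable_matrixMatroid_of_transfer (B := A.map (algebraMap K R))
    (fun u hu => ?_) hdown fun u hu => ?_
  · obtain ⟨v, h1, -, h3⟩ := hup u hu
    exact ⟨v, h1, h3⟩
  · obtain ⟨v, h1, h2⟩ := hdown u hu
    obtain ⟨w, h3, h4, h5⟩ := hup v h1
    exact ⟨w, h3, h4, h5.trans h2⟩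

end Reid

/-! ### Representing the Dowling geometry from a quaternion group with unit differences -/

section Dowling

/-- The multiplication table of the quaternion group, in the enumeration
`1, -1, i, -i, j, -j, k, -k`. -/
def quaternionMul : Fin 8 → Fin 8 → Fin 8 :=
  ![![0, 1, 2, 3, 4, 5, 6, 7], ![1, 0, 3, 2, 5, 4, 7, 6], ![2, 3, 1, 0, 6, 7, 5, 4],
    ![3, 2, 0, 1, 7, 6, 4, 5], ![4, 5, 7, 6, 1, 0, 2, 3], ![5, 4, 6, 7, 0, 1, 3, 2],
    ![6, 7, 4, 5, 3, 2, 1, 0], ![7, 6, 5, 4, 2, 3, 0, 1]]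

theorem exists_quaternionMul_eq_zero (n : Fin 8) : ∃ m, quaternionMul n m = 0 := by
  revert n
  decide

/-- A copy of the quaternion group in a ring in which differences of distinct elements are units. -/
structure IsQuaternionFamily {S : Type*} [Ring S] (g : Fin 8 → S) : Prop where
  map_zero : g 0 = 1
  map_mul : ∀ n m, g n * g m = g (quaternionMul n m)
  isUnit_sub : ∀ n m, n ≠ m → IsUnit (g n - g m)

/-- The columns of the matrix of `Q_3(G)`, for the elements of `G` in an arbitrary ring. -/
def dowlingColumn {S : Type*} [Ring S] (g : Fin 8 → S) :
    Fin 3 ⊕ Fin 8 ⊕ Fin 8 ⊕ Fin 8 → Fin 3 → S :=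
  Sum.elim (fun n => Pi.single n 1) <|
  Sum.elim (fun n => ![-1, g n, 0]) <|
  Sum.elim (fun n => ![0, -1, g n])
    (fun n => ![g n, 0, -1])

/-- The matrix of `Q_3(G)`, for the elements of `G` in an arbitrary ring. -/
def dowlingMatrix {S : Type*} [Ring S] (g : Fin 8 → S) :
    Matrix (Fin 3) (Fin 3 ⊕ Fin 8 ⊕ Fin 8 ⊕ Fin 8) S :=
  Matrix.of fun x y => dowlingColumn g y x

section

variable {S : Type*} [Ring S] (g : Fin 8 → S) (u : Fin 3 → S)

@[simp]
theorem vecMul_dowlingMatrix_unit (t : Fin 3) :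
    Matrix.vecMul u (dowlingMatrix g) (Sum.inl t) = u t := by
  simp [Matrix.vecMul, dotProduct, dowlingMatrix, dowlingColumn, Pi.single_apply]

@[simp]
theorem vecMul_dowlingMatrix_a (n : Fin 8) :
    Matrix.vecMul u (dowlingMatrix g) (Sum.inr (Sum.inl n)) = u 1 * g n - u 0 := by
  simp [Matrix.vecMul, dotProduct, dowlingMatrix, dowlingColumn, Fin.sum_univ_three]
  abel

@[simp]
theorem vecMul_dowlingMatrix_b (n : Fin 8) :
    Matrix.vecMul u (dowlingMatrix g) (Sum.inr (Sum.inr (Sum.inl n))) = u 2 * g n - u 1 := by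
  simp [Matrix.vecMul, dotProduct, dowlingMatrix, dowlingColumn, Fin.sum_univ_three]
  abel

@[simp]
theorem vecMul_dowlingMatrix_c (n : Fin 8) :
    Matrix.vecMul u (dowlingMatrix g) (Sum.inr (Sum.inr (Sum.inr n))) = u 0 * g n - u 2 := by
  simp [Matrix.vecMul, dotProduct, dowlingMatrix, dowlingColumn, Fin.sum_univ_three]
  abel

theorem vecMul_dowlingMatrix_ne_zero : Matrix.vecMul u (dowlingMatrix g) ≠ 0 ↔ ∃ t, u t ≠ 0 := by
  refine ⟨fun h => ?_, fun ⟨t, ht⟩ => vecMul_ne_zero_iff.2 ⟨Sum.inl t, by simpa using ht⟩⟩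
  by_contra! h0
  obtain rfl : u = 0 := funext h0
  simp at h

end

variable {S S' : Type*} [Ring S] [Ring S'] {g : Fin 8 → S} {g' : Fin 8 → S'}

theorem IsQuaternionFamily.isUnit (hg : IsQuaternionFamily g) (n : Fin 8) : IsUnit (g n) := by
  have h : ∀ n, ∃ m, quaternionMul n m = 0 ∧ quaternionMul m n = 0 := by decide
  obtain ⟨m, h1, h2⟩ := h n
  exact ⟨⟨g n, g m, by rw [hg.map_mul, h1, hg.map_zero], by rw [hg.map_mul, h2, hg.map_zero]⟩, rfl⟩

/-- Each nonzero vector over `S` is dominated, on the columns of the Dowling geometry, by a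
nonzero vector over `S'` with entries in `G ∪ {0}`. -/
theorem IsQuaternionFamily.exists_transfer [Nontrivial S'] (hg : IsQuaternionFamily g)
    (hg' : IsQuaternionFamily g') (u : Fin 3 → S)
    (hu : Matrix.vecMul u (dowlingMatrix g) ≠ 0) :
    ∃ w, Matrix.vecMul w (dowlingMatrix g') ≠ 0 ∧
      (∀ e, Matrix.vecMul w (dowlingMatrix g') e = 0 ∨
        IsUnit (Matrix.vecMul w (dowlingMatrix g') e)) ∧
      support (Matrix.vecMul w (dowlingMatrix g')) ⊆
        support (Matrix.vecMul u (dowlingMatrix g)) := by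
  classical
  obtain ⟨t, ht⟩ := (vecMul_dowlingMatrix_ne_zero g u).1 hu
  -- `w` retains only the coordinates of `u` in the orbit of `u t` under right multiplication by the
  -- group, recording the group element in place of the coordinate.
  let w : Fin 3 → S' := fun s => if h : ∃ n, u s = u t * g n then g' h.choose else 0
  -- Unit differences make the group element recorded by `w` unique, even though `S` may have zero
  -- divisors.
  have hinj : ∀ n m, u t * g n = u t * g m → n = m := by
    intro n m h
    by_contra hnm
    refine ht (((hg.isUnit_sub n m hnm).mul_left_eq_zero).1 ?_)
    rw [mul_sub, h, sub_self]
  have hw1 : ∀ s n, u s = u t * g n → w s = g' n := by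
    intro s n h
    have hex : ∃ n, u s = u t * g n := ⟨n, h⟩
    have : w s = g' hex.choose := dif_pos hex
    rw [this, hinj _ n (hex.choose_spec.symm.trans h)]
  have hw0 : ∀ s, (¬ ∃ n, u s = u t * g n) → w s = 0 := fun s h => dif_neg h
  -- Two linked coordinates lie in the same orbit, so they are kept or dropped together. This is
  -- what carries zeros at the columns `a`, `b`, `c` from `u` to `w`.
  have hlink : ∀ s s' n, u s = u s' * g n → w s = w s' * g' n := by
    intro s s' n h
    by_cases hs' : ∃ m, u s' = u t * g m
    · obtain ⟨m, hm⟩ := hs'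
      rw [hw1 s' m hm, hg'.map_mul]
      exact hw1 _ _ (by rw [h, hm, mul_assoc, hg.map_mul])
    · rw [hw0 s' hs', zero_mul]
      refine hw0 s fun ⟨m, hm⟩ => hs' ?_
      obtain ⟨k, hk⟩ := exists_quaternionMul_eq_zero n
      refine ⟨quaternionMul m k, ?_⟩
      rw [← hg.map_mul, ← mul_assoc, ← hm, h, mul_assoc, hg.map_mul, hk, hg.map_zero, mul_one]
  have hwu : ∀ s, w s = 0 ∨ ∃ n, w s = g' n := by
    intro s
    by_cases h : ∃ n, u s = u t * g n
    · obtain ⟨n, hn⟩ := h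
      exact Or.inr ⟨n, hw1 s n hn⟩
    · exact Or.inl (hw0 s h)
  have hdiff : ∀ s s' n, w s' * g' n - w s = 0 ∨ IsUnit (w s' * g' n - w s) := by
    intro s s' n
    rcases hwu s with h | ⟨m, h⟩ <;> rcases hwu s' with h' | ⟨m', h'⟩ <;> rw [h, h']
    · simp
    · rw [sub_zero, hg'.map_mul]
      exact Or.inr (hg'.isUnit _)
    · rw [zero_mul, zero_sub]
      exact Or.inr (hg'.isUnit _).neg
    · rw [hg'.map_mul]
      by_cases hmm : quaternionMul m' n = m
      · exact Or.inl (by rw [hmm, sub_self])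
      · exact Or.inr (hg'.isUnit_sub _ _ hmm)
  refine ⟨w, (vecMul_dowlingMatrix_ne_zero g' w).2 ⟨t, ?_⟩, ?_, ?_⟩
  · rw [hw1 t 0 (by rw [hg.map_zero, mul_one]), hg'.map_zero]
    exact one_ne_zero
  · rintro (s | n | n | n)
    · rw [vecMul_dowlingMatrix_unit]
      exact (hwu s).imp_right fun ⟨n, hn⟩ => hn ▸ hg'.isUnit n
    · rw [vecMul_dowlingMatrix_a]
      exact hdiff _ _ _
    · rw [vecMul_dowlingMatrix_b]
      exact hdiff _ _ _
    · rw [vecMul_dowlingMatrix_c]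
      exact hdiff _ _ _
  · rintro (s | n | n | n) he <;> rw [mem_support] at he ⊢ <;>
      refine fun h => he ?_ <;> simp only [vecMul_dowlingMatrix_unit, vecMul_dowlingMatrix_a,
        vecMul_dowlingMatrix_b, vecMul_dowlingMatrix_c] at h ⊢
    · refine hw0 s fun ⟨n, hn⟩ => ht ?_
      exact ((hg.isUnit n).mul_left_eq_zero).1 (hn ▸ h)
    all_goals exact sub_eq_zero.2 (hlink _ _ _ (sub_eq_zero.1 h).symm).symm

/-- The coordinates of the elements of the quaternion group. -/
def quaternionGroupCoord : Fin 8 → Fin 4 → ℤ :=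
  ![![1, 0, 0, 0], ![-1, 0, 0, 0], ![0, 1, 0, 0], ![0, -1, 0, 0], ![0, 0, 1, 0], ![0, 0, -1, 0],
    ![0, 0, 0, 1], ![0, 0, 0, -1]]

/-- The elements of the quaternion group inside the quaternions over a commutative ring. -/
def quaternionGroupEltOf (K : Type*) [CommRing K] (n : Fin 8) : ℍ[K] :=
  ⟨quaternionGroupCoord n 0, quaternionGroupCoord n 1, quaternionGroupCoord n 2,
    quaternionGroupCoord n 3⟩

theorem isUnit_quaternion {K : Type*} [CommRing K] {q : ℍ[K]} (h : IsUnit (Quaternion.normSq q)) :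
    IsUnit q := by
  have hc : Commute q (star q) := by
    rw [Commute, SemiconjBy, Quaternion.self_mul_star, Quaternion.star_mul_self]
  refine (hc.isUnit_mul_iff.1 ?_).1
  rw [Quaternion.self_mul_star]
  exact h.map (algebraMap K ℍ[K])

theorem isQuaternionFamily_quaternionGroupEltOf {K : Type*} [CommRing K] (h2 : IsUnit (2 : K)) :
    IsQuaternionFamily (quaternionGroupEltOf K) where
  map_zero := by
    ext <;> simp [quaternionGroupEltOf, quaternionGroupCoord]
  map_mul n m := by
    ext
    -- All coordinates are casts of integers, so the multiplication table is checked once over ℤ for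
    -- every `K`.
    · rw [Quaternion.re_mul]
      simp only [quaternionGroupEltOf]
      norm_cast
      congr 1
      revert n m
      decide
    · rw [Quaternion.imI_mul]
      simp only [quaternionGroupEltOf]
      norm_cast
      congr 1
      revert n m
      decide
    · rw [Quaternion.imJ_mul]
      simp only [quaternionGroupEltOf]
      norm_cast
      congr 1
      revert n m
      decide
    · rw [Quaternion.imK_mul]
      simp only [quaternionGroupEltOf]
      norm_cast
      congr 1
      revert n m
      decide
  isUnit_sub n m h := by
    -- The norm of a difference is 4 for opposite elements and 2 for other distinct ones.
    have key : ∀ n m, n ≠ m →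
        (quaternionGroupCoord n 0 - quaternionGroupCoord m 0) ^ 2 +
        (quaternionGroupCoord n 1 - quaternionGroupCoord m 1) ^ 2 +
        (quaternionGroupCoord n 2 - quaternionGroupCoord m 2) ^ 2 +
        (quaternionGroupCoord n 3 - quaternionGroupCoord m 3) ^ 2 = 2 ∨
        (quaternionGroupCoord n 0 - quaternionGroupCoord m 0) ^ 2 +
        (quaternionGroupCoord n 1 - quaternionGroupCoord m 1) ^ 2 +
        (quaternionGroupCoord n 2 - quaternionGroupCoord m 2) ^ 2 +
        (quaternionGroupCoord n 3 - quaternionGroupCoord m 3) ^ 2 = 2 ^ 2 := by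
      decide
    refine isUnit_quaternion ?_
    rw [Quaternion.normSq_def', Quaternion.re_sub, Quaternion.imI_sub, Quaternion.imJ_sub,
      Quaternion.imK_sub]
    simp only [quaternionGroupEltOf]
    norm_cast
    rcases key n m h with h' | h' <;> rw [h']
    · simpa using h2
    · rw [Int.cast_pow, Int.cast_ofNat]
      exact h2.pow 2

theorem quaternionGroupElt_eq : quaternionGroupElt = quaternionGroupEltOf ℝ := by
  funext n
  fin_cases n <;> ext <;> simp [quaternionGroupElt, quaternionGroupEltOf, quaternionGroupCoord]

theorem isQuaternionFamily_quaternionGroupElt : IsQuaternionFamily quaternionGroupElt := by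
  rw [quaternionGroupElt_eq]
  exact isQuaternionFamily_quaternionGroupEltOf (IsUnit.mk0 _ two_ne_zero)

theorem isRepresentable_Q3_quaternion {K : Type*} [CommRing K] [Nontrivial K]
    (h2 : IsUnit (2 : K)) : IsRepresentable (SkewPartialField.allUnits ℍ[K]) Q3 := by
  have h := isQuaternionFamily_quaternionGroupElt
  have h' := isQuaternionFamily_quaternionGroupEltOf h2
  refine isRepresentable_matrixMatroid_of_transfer (A := dowlingMatrix quaternionGroupElt)
    (B := dowlingMatrix (quaternionGroupEltOf K))
    (fun u hu => ?_) (fun u hu => ?_) fun u hu => ?_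
  · obtain ⟨v, h1, -, h3⟩ := h.exists_transfer h' u hu
    exact ⟨v, h1, h3⟩
  · obtain ⟨v, h1, -, h3⟩ := h'.exists_transfer h u hu
    exact ⟨v, h1, h3⟩
  · exact h'.exists_transfer h' u hu

end Dowling

end ChainGroup

namespace ChainGroup

/-! ### Chains realizing the rows and cocircuits of a matrix -/

section Cocircuits

variable {R : Type*} [Ring R] {D : Type*} [DivisionRing D] {X E : Type*} [Fintype X]

/-- The row combination of `A` with coefficient vector `u` is determined up to a scalar by its
zeros. -/
def IsCocircuitVector (A : Matrix X E D) (u : X → D) : Prop :=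
  u ≠ 0 ∧ ∀ v, (∀ e, Matrix.vecMul u A e = 0 → Matrix.vecMul v A e = 0) → ∃ r : D, v = r • u

/-- If a nonzero chain under the support of `u A` had an extra zero, every row combination vanishing
with it would be a multiple of `u A` vanishing there too, hence zero, forcing the chain to be zero.
-/
theorem IsCocircuitVector.exists_chain [Finite E] {P : SkewPartialField R}
    {C : Submodule R (E → R)} (hC : IsChainGroup P C) {A : Matrix X E D}
    (hCI : ∀ I, IsCoindep (Submodule.span D (Set.range A.row)) I ↔ IsCoindep C I)
    {u : X → D} (hu : IsCocircuitVector A u) (hA : Matrix.vecMul u A ≠ 0) :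
    ∃ c ∈ C, (∀ e, Matrix.vecMul u A e = 0 → c e = 0) ∧
      ∀ e, Matrix.vecMul u A e ≠ 0 → IsUnit (c e) := by
  obtain ⟨c, hc, hc0, hcu, hcz⟩ := exists_chain_of_vecMul hC hCI u hA
  refine ⟨c, hc, hcz, fun e he => (hcu e).resolve_left fun hce => hc0 ?_⟩
  refine eq_zero_of_forall_vecMul hCI hc fun v hv => ?_
  obtain ⟨r, rfl⟩ := hu.2 v fun e he => hv e (hcz e he)
  have h := hv e hce
  rw [Matrix.smul_vecMul, Pi.smul_apply, smul_eq_mul] at h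
  rw [(mul_eq_zero.1 h).resolve_right he, zero_smul, Matrix.zero_vecMul]

/-- A chain group representing the matroid of a matrix `A` that contains an identity matrix has a
basis of chains with the same zeros as the rows of `A`, and each cocircuit is realized by a
combination of these chains. -/
theorem exists_basis_chains [Finite E] [DecidableEq X] {P : SkewPartialField R}
    {C : Submodule R (E → R)} (hC : IsChainGroup P C) {A : Matrix X E D}
    (hCI : ∀ I, IsCoindep (Submodule.span D (Set.range A.row)) I ↔ IsCoindep C I)
    {base : X → E} (hbase : ∀ u t, Matrix.vecMul u A (base t) = u t)
    {norm : X → E} (hnorm : ∀ t, A t (norm t) ≠ 0) :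
    ∃ c : X → E → R, (∀ t e, A t e = 0 → c t e = 0) ∧ (∀ t e, A t e ≠ 0 → IsUnit (c t e)) ∧
      (∀ t, c t (norm t) = 1) ∧ ∀ u, IsCocircuitVector A u → ∃ s : X → R,
        (∀ t, u t = 0 → s t = 0) ∧ (∀ t, u t ≠ 0 → IsUnit (s t)) ∧
        (∀ e, Matrix.vecMul u A e = 0 → ∑ t, s t * c t e = 0) ∧
        ∀ e, Matrix.vecMul u A e ≠ 0 → IsUnit (∑ t, s t * c t e) := by
  have hne : ∀ u : X → D, u ≠ 0 → Matrix.vecMul u A ≠ 0 := by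
    intro u hu
    obtain ⟨t, ht⟩ := Function.ne_iff.1 hu
    exact vecMul_ne_zero_iff.2 ⟨base t, by rwa [hbase]⟩
  have hsingle : ∀ t, IsCocircuitVector A (Pi.single t 1) := by
    refine fun t => ⟨by simp, fun v hv => ⟨v t, funext fun s => ?_⟩⟩
    by_cases hst : s = t
    · subst hst
      simp
    · have := hv (base s)
      rw [hbase, hbase] at this
      simp [this (by simp [hst]), hst]
  have hex := fun t => (hsingle t).exists_chain hC hCI (hne _ (hsingle t).1)
  simp only [Matrix.single_one_vecMul, Matrix.row] at hex
  choose c₀ hc₀ hc₀z hc₀u using hex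
  choose w hw using fun t => hc₀u t (norm t) (hnorm t)
  let c : X → E → R := fun t => ((w t)⁻¹ : Rˣ).1 • c₀ t
  have hc : ∀ t, c t ∈ C := fun t => C.smul_mem _ (hc₀ t)
  have hcz : ∀ t e, A t e = 0 → c t e = 0 := fun t e h => by simp [c, hc₀z t e h]
  have hcu : ∀ t e, A t e ≠ 0 → IsUnit (c t e) := fun t e h =>
    ((w t)⁻¹).isUnit.mul (hc₀u t e h)
  have hA : ∀ s t, A s (base t) = if s = t then 1 else 0 := by
    intro s t
    have := hbase (Pi.single s 1) t
    rw [Matrix.single_one_vecMul] at this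
    rw [show A s (base t) = _ from this, Pi.single_apply]
    simp [eq_comm]
  refine ⟨c, hcz, hcu, fun t => by simp [c, ← hw], fun u hu => ?_⟩
  obtain ⟨d, hd, hdz, hdu⟩ := hu.exists_chain hC hCI (hne u hu.1)
  choose b hb using fun t => hcu t (base t) (by simp [hA])
  -- Chosen so that the combination of the `c t` agrees with `d` on the base; a chain vanishing on
  -- the base is zero.
  let s : X → R := fun t => d (base t) * ((b t)⁻¹ : Rˣ).1
  have hds : ∀ e, ∑ t, s t * c t e = d e := by
    have hmem : d - ∑ t, s t • c t ∈ C :=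
      C.sub_mem hd (C.sum_mem fun t _ => C.smul_mem _ (hc t))
    have h0 := eq_zero_of_forall_vecMul hCI hmem fun v hv => by
      have hv0 : v = 0 := by
        funext t
        rw [← hbase v t]
        refine hv (base t) ?_
        rw [Pi.sub_apply, Finset.sum_apply, Finset.sum_eq_single t]
        · simp [s, ← hb]
        · intro s' _ hs'
          simp [hcz s' (base t) (by simp [hA, hs'])]
        · simp
      rw [hv0, Matrix.zero_vecMul]
    intro e
    have := congrFun h0 e
    simp only [Pi.sub_apply, Finset.sum_apply, Pi.smul_apply, smul_eq_mul, Pi.zero_apply] at this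
    exact (sub_eq_zero.1 this).symm
  refine ⟨s, fun t ht => ?_, fun t ht => ?_, fun e he => ?_, fun e he => ?_⟩
  · simp [s, hdz (base t) (by rwa [hbase])]
  · exact (hdu (base t) (by rwa [hbase])).mul ((b t)⁻¹).isUnit
  · rw [hds, hdz e he]
  · rw [hds]
    exact hdu e he

end Cocircuits

/-! ### The Reid geometry forces characteristic three -/

section Reid

theorem R9_eq : R9 = matrixMatroid reidMatrix := rfl

/-- Each vector is the equation of a line of the geometry; these six lines suffice to derive 3 = 0.
-/
theorem isCocircuitVector_reidMatrix {u : Fin 3 → ZMod 3} (hu : u ∈ ({![1, -1, 0], ![0, 1, -1],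
    ![1, 0, -1], ![1, 1, -1], ![1, -1, -1], ![1, 1, 1]} : Set (Fin 3 → ZMod 3))) :
    IsCocircuitVector reidMatrix u := by
  have key : ∀ u ∈ [![1, -1, 0], ![0, 1, -1], ![1, 0, -1], ![1, 1, -1], ![1, -1, -1], ![1, 1, 1]],
      u ≠ 0 ∧ ∀ v, (∀ e, Matrix.vecMul u reidMatrix e = 0 → Matrix.vecMul v reidMatrix e = 0) →
        ∃ r : ZMod 3, v = r • u := by
    decide +kernel
  exact key u (by simpa using hu)

theorem nontrivial_of_isRepresentable_R9 {R : Type*} [Ring R] {P : SkewPartialField R}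
    (h : IsRepresentable P R9) : Nontrivial R := by
  obtain ⟨C, hC, -, hI⟩ := isRepresentable_iff.1 h
  have hCI : ∀ I, IsCoindep (Submodule.span (ZMod 3) (Set.range reidMatrix.row)) I ↔
      IsCoindep C I := fun I => by rw [← hI, R9_eq, matrixMatroid, matroid_dual_indep_iff]
  obtain ⟨c, -, hc0, -⟩ := exists_chain_of_vecMul hC hCI ![1, 0, 0] (by decide)
  obtain ⟨e, he⟩ := Function.ne_iff.1 hc0
  exact nontrivial_of_ne _ _ he

/-- A ring over which the Reid geometry is representable has `3 = 0`. -/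
theorem three_eq_zero_of_isRepresentable_R9 {R : Type*} [Ring R] {P : SkewPartialField R}
    (h : IsRepresentable P R9) : (3 : R) = 0 := by
  obtain ⟨C, hC, -, hI⟩ := isRepresentable_iff.1 h
  have hCI : ∀ I, IsCoindep (Submodule.span (ZMod 3) (Set.range reidMatrix.row)) I ↔
      IsCoindep C I := fun I => by rw [← hI, R9_eq, matrixMatroid, matroid_dual_indep_iff]
  -- Column 3 of the matrix has no zero entry, so all three chains can be scaled to 1 there.
  obtain ⟨c, hcz, hcu, hc1, hc⟩ := exists_basis_chains hC hCI (base := Fin.castLE (by decide))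
    (by decide +kernel) (norm := fun _ => 3) (by decide)
  have hcoc := fun u hu => hc u (isCocircuitVector_reidMatrix hu)
  simp only [Fin.sum_univ_three] at hcoc
  -- The first three lines pass through the normalized column 3, which makes the two units in each
  -- of columns 4, 6, 8 equal. The next two then make those in columns 5 and 7 opposite.
  have h4 : c 0 4 = c 1 4 := by
    obtain ⟨s, hs0, hsu, hz, -⟩ := hcoc ![1, -1, 0] (by simp)
    have e1 := hz 3 (by decide)
    have e2 := hz 4 (by decide)
    simp only [hs0 2 (by decide), hc1, zero_mul, add_zero, mul_one] at e1 e2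
    rw [eq_neg_of_add_eq_zero_right e1, neg_mul, ← sub_eq_add_neg, ← mul_sub,
      (hsu 0 (by decide)).mul_right_eq_zero, sub_eq_zero] at e2
    exact e2
  have h6 : c 1 6 = c 2 6 := by
    obtain ⟨s, hs0, hsu, hz, -⟩ := hcoc ![0, 1, -1] (by simp)
    have e1 := hz 3 (by decide)
    have e2 := hz 6 (by decide)
    simp only [hs0 0 (by decide), hc1, zero_mul, zero_add, mul_one] at e1 e2
    rw [eq_neg_of_add_eq_zero_right e1, neg_mul, ← sub_eq_add_neg, ← mul_sub,
      (hsu 1 (by decide)).mul_right_eq_zero, sub_eq_zero] at e2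
    exact e2
  have h8 : c 0 8 = c 2 8 := by
    obtain ⟨s, hs0, hsu, hz, -⟩ := hcoc ![1, 0, -1] (by simp)
    have e1 := hz 3 (by decide)
    have e2 := hz 8 (by decide)
    simp only [hs0 1 (by decide), hc1, zero_mul, add_zero, mul_one] at e1 e2
    rw [eq_neg_of_add_eq_zero_right e1, neg_mul, ← sub_eq_add_neg, ← mul_sub,
      (hsu 0 (by decide)).mul_right_eq_zero, sub_eq_zero] at e2
    exact e2
  have z : ∀ t e, reidMatrix t e = 0 → ∀ x, x * c t e = 0 := fun t e h x => by
    rw [hcz t e h, mul_zero]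
  have h5 : c 0 5 + c 1 5 = 0 := by
    obtain ⟨s, -, hsu, hz, -⟩ := hcoc ![1, 1, -1] (by simp)
    have e1 := hz 6 (by decide)
    have e2 := hz 8 (by decide)
    have e3 := hz 5 (by decide)
    rw [z 0 6 (by decide), zero_add, h6, ← add_mul, (hcu 2 6 (by decide)).mul_left_eq_zero] at e1
    rw [z 1 8 (by decide), add_zero, h8, ← add_mul, (hcu 2 8 (by decide)).mul_left_eq_zero] at e2
    rw [z 2 5 (by decide), add_zero, add_right_cancel (e2.trans e1.symm), ← mul_add,
      (hsu 1 (by decide)).mul_right_eq_zero] at e3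
    exact e3
  have h7 : c 1 7 + c 2 7 = 0 := by
    obtain ⟨s, -, hsu, hz, -⟩ := hcoc ![1, -1, -1] (by simp)
    have e1 := hz 4 (by decide)
    have e2 := hz 8 (by decide)
    have e3 := hz 7 (by decide)
    rw [z 2 4 (by decide), add_zero, h4, ← add_mul, (hcu 1 4 (by decide)).mul_left_eq_zero] at e1
    rw [z 1 8 (by decide), add_zero, h8, ← add_mul, (hcu 2 8 (by decide)).mul_left_eq_zero] at e2
    rw [z 0 7 (by decide), zero_add, add_left_cancel (e1.trans e2.symm), ← mul_add,
      (hsu 2 (by decide)).mul_right_eq_zero] at e3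
    exact e3
  -- On the last line, columns 5 and 7 give `s 0 = s 1 = s 2`, while column 3 gives `s 0 + s 1 + s 2
  -- = 0`. Thus the unit `s 0` is killed by 3.
  obtain ⟨s, -, hsu, hz, -⟩ := hcoc ![1, 1, 1] (by simp)
  have e1 := hz 3 (by decide)
  have e2 := hz 5 (by decide)
  have e3 := hz 7 (by decide)
  simp only [hc1, mul_one] at e1
  rw [z 2 5 (by decide), add_zero, eq_neg_of_add_eq_zero_left h5, mul_neg, neg_add_eq_sub,
    ← sub_mul, (hcu 1 5 (by decide)).mul_left_eq_zero, sub_eq_zero] at e2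
  rw [z 0 7 (by decide), zero_add, eq_neg_of_add_eq_zero_left h7, mul_neg, neg_add_eq_sub,
    ← sub_mul, (hcu 2 7 (by decide)).mul_left_eq_zero, sub_eq_zero] at e3
  rw [e3, e2] at e1
  refine (hsu 0 (by decide)).mul_right_eq_zero.1 (Eq.trans ?_ e1)
  rw [show (3 : R) = 1 + 1 + 1 by norm_num, mul_add, mul_add, mul_one]

end Reid

/-! ### The Dowling geometry forces a quaternion group with unit differences -/

section Dowling

/-- Up to a unit factor on the right, which does not affect zeros or units, a column with two unit
entries is described by a single unit. -/
theorem exists_add_mul_eq {R : Type*} [Ring R] {p q : R} (hp : IsUnit p) (hq : IsUnit q) :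
    ∃ a : Rˣ, ∀ x y : R, x * p + y * q = (x - y * a) * p := by
  obtain ⟨p, rfl⟩ := hp
  obtain ⟨q, rfl⟩ := hq
  refine ⟨-(q * p⁻¹), fun x y => ?_⟩
  simp [add_mul, mul_assoc]

variable {D : Type*} [DivisionRing D] {g : Fin 8 → D}

theorem isCocircuitVector_dowlingMatrix_two (n : Fin 8) :
    IsCocircuitVector (dowlingMatrix g) ![g n, 1, 0] := by
  refine ⟨fun h => one_ne_zero (congrFun h 1), fun v hv => ⟨v 1, funext fun t => ?_⟩⟩
  have h1 := hv (Sum.inl 2) (by simp)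
  have h2 := hv (Sum.inr (Sum.inl n)) (by simp)
  rw [vecMul_dowlingMatrix_unit] at h1
  rw [vecMul_dowlingMatrix_a, sub_eq_zero] at h2
  fin_cases t <;> simp [h1, h2]

theorem isCocircuitVector_dowlingMatrix_three (n m : Fin 8) :
    IsCocircuitVector (dowlingMatrix g) ![g m * g n, g m, 1] := by
  refine ⟨fun h => one_ne_zero (congrFun h 2), fun v hv => ⟨v 2, funext fun t => ?_⟩⟩
  have h1 := hv (Sum.inr (Sum.inr (Sum.inl m))) (by simp)
  have h2 := hv (Sum.inr (Sum.inl n)) (by simp)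
  rw [vecMul_dowlingMatrix_b, sub_eq_zero] at h1
  rw [vecMul_dowlingMatrix_a, sub_eq_zero] at h2
  fin_cases t <;> simp [← h1, ← h2, mul_assoc]

theorem Q3_eq : Q3 = matrixMatroid (dowlingMatrix quaternionGroupElt) := rfl

/-- A ring over which `Q_3(G)` is representable contains a copy of the group `G` in which all
differences are units. -/
theorem exists_isQuaternionFamily_of_isRepresentable_Q3 {R : Type*} [Ring R]
    {P : SkewPartialField R} (h : IsRepresentable P Q3) :
    ∃ ρ : Fin 8 → R, IsQuaternionFamily ρ := by
  have hg := isQuaternionFamily_quaternionGroupElt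
  have hg0 : ∀ n, quaternionGroupElt n ≠ 0 := fun n => (hg.isUnit n).ne_zero
  set g := quaternionGroupElt with hgdef
  obtain ⟨C, hC, -, hI⟩ := isRepresentable_iff.1 h
  have hCI : ∀ I, IsCoindep (Submodule.span ℍ[ℝ] (Set.range (dowlingMatrix g).row)) I ↔
      IsCoindep C I := fun I => by rw [← hI, Q3_eq, matrixMatroid, matroid_dual_indep_iff]
  obtain ⟨c, hcz, hcu, -, hc⟩ := exists_basis_chains hC hCI (base := Sum.inl)
    (vecMul_dowlingMatrix_unit g) (norm := Sum.inl)
    (fun t => by simp [dowlingMatrix, dowlingColumn])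
  simp only [Fin.sum_univ_three] at hc
  choose a ha using fun n => exists_add_mul_eq
    (hcu 0 (Sum.inr (Sum.inl n)) (by simp [dowlingMatrix, dowlingColumn]))
    (hcu 1 (Sum.inr (Sum.inl n)) (by simp [dowlingMatrix, dowlingColumn, hg0]))
  choose b hb using fun n => exists_add_mul_eq
    (hcu 1 (Sum.inr (Sum.inr (Sum.inl n))) (by simp [dowlingMatrix, dowlingColumn]))
    (hcu 2 (Sum.inr (Sum.inr (Sum.inl n))) (by simp [dowlingMatrix, dowlingColumn, hg0]))
  choose k hk using fun n => exists_add_mul_eq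
    (hcu 2 (Sum.inr (Sum.inr (Sum.inr n))) (by simp [dowlingMatrix, dowlingColumn]))
    (hcu 0 (Sum.inr (Sum.inr (Sum.inr n))) (by simp [dowlingMatrix, dowlingColumn, hg0]))
  have hsa : ∀ (s : Fin 3 → R) n, s 0 * c 0 (Sum.inr (Sum.inl n)) +
      s 1 * c 1 (Sum.inr (Sum.inl n)) + s 2 * c 2 (Sum.inr (Sum.inl n)) =
      (s 0 - s 1 * a n) * c 0 (Sum.inr (Sum.inl n)) := by
    intro s n
    rw [hcz 2 (Sum.inr (Sum.inl n)) (by simp [dowlingMatrix, dowlingColumn]), mul_zero, add_zero,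
      ha]
  have hua : ∀ n, IsUnit (c 0 (Sum.inr (Sum.inl n))) := fun n =>
    hcu _ _ (by simp [dowlingMatrix, dowlingColumn])
  have hsub : ∀ n m, n ≠ m → IsUnit ((a n : R) - a m) := by
    intro n m hnm
    obtain ⟨s, -, hsu, hz, hnz⟩ := hc _ (isCocircuitVector_dowlingMatrix_two (g := g) n)
    have e1 := hz (Sum.inr (Sum.inl n)) (by simp)
    have e2 := hnz (Sum.inr (Sum.inl m)) (by
      simpa [sub_eq_zero] using sub_ne_zero.1 (hg.isUnit_sub m n hnm.symm).ne_zero)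
    rw [hsa, (hua n).mul_left_eq_zero, sub_eq_zero] at e1
    rw [hsa, e1, ← mul_sub] at e2
    obtain ⟨y, hy⟩ := hsu 1 (by simp)
    obtain ⟨p, hp⟩ := hua m
    rw [← hy, ← hp] at e2
    simpa using e2
  -- When the group product is 1, the columns `b m`, `a n`, `c l` lie on one line, and going round
  -- the triangle returns the unit `s 2` to itself.
  have htriple : ∀ n m l, quaternionMul (quaternionMul m n) l = 0 → b m * a n * k l = 1 := by
    intro n m l hnml
    obtain ⟨s, -, hsu, hz, -⟩ := hc _ (isCocircuitVector_dowlingMatrix_three (g := g) n m)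
    have e1 := hz (Sum.inr (Sum.inl n)) (by simp)
    have e2 := hz (Sum.inr (Sum.inr (Sum.inl m))) (by simp)
    have e3 := hz (Sum.inr (Sum.inr (Sum.inr l))) (by
      simp [hg.map_mul, hnml, hg.map_zero])
    rw [hsa, (hua n).mul_left_eq_zero, sub_eq_zero] at e1
    rw [hcz 0 (Sum.inr (Sum.inr (Sum.inl m))) (by simp [dowlingMatrix, dowlingColumn]), mul_zero,
      zero_add, hb, (hcu 1 (Sum.inr (Sum.inr (Sum.inl m)))
        (by simp [dowlingMatrix, dowlingColumn])).mul_left_eq_zero, sub_eq_zero] at e2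
    rw [hcz 1 (Sum.inr (Sum.inr (Sum.inr l))) (by simp [dowlingMatrix, dowlingColumn]), mul_zero,
      add_zero, add_comm, hk, (hcu 2 (Sum.inr (Sum.inr (Sum.inr l)))
        (by simp [dowlingMatrix, dowlingColumn])).mul_left_eq_zero, sub_eq_zero, e1, e2] at e3
    obtain ⟨z, hz⟩ := hsu 2 (by simp)
    rw [← hz] at e3
    have h1 : z = z * b m * a n * k l := by
      ext
      simpa using e3
    rwa [mul_assoc, mul_assoc, left_eq_mul, ← mul_assoc] at h1
  have hzero : ∀ n, quaternionMul 0 n = n ∧ quaternionMul n 0 = n := by decide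
  -- By the triangle relation `b m * a n` is the inverse of `k l`, where `l` depends only on the
  -- product of `m` and `n`.
  have hba : ∀ n m, b m * a n = b 0 * a (quaternionMul m n) := by
    intro n m
    obtain ⟨l, hl⟩ := exists_quaternionMul_eq_zero (quaternionMul m n)
    refine mul_right_cancel ((htriple n m l hl).trans (htriple _ 0 l ?_).symm)
    rw [(hzero _).1, hl]
  -- Dividing by `a 0` sends the identity to 1. The same unit equals `(b 0)⁻¹ * b n`, so a product
  -- of two can be evaluated with `hba`.
  refine ⟨fun n => (a n * (a 0)⁻¹ : Rˣ), by simp, fun n m => ?_, fun n m hnm => ?_⟩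
  · rw [← Units.val_mul]
    congr 1
    have h1 := hba 0 n
    rw [(hzero n).2] at h1
    have h2 : a n * (a 0)⁻¹ = (b 0)⁻¹ * b n := by
      rw [mul_inv_eq_iff_eq_mul, mul_assoc, h1, inv_mul_cancel_left]
    rw [h2, mul_assoc, ← mul_assoc (b n), hba, mul_assoc, inv_mul_cancel_left]
  · rw [Units.val_mul, Units.val_mul, ← sub_mul]
    exact (hsub n m hnm).mul (Units.isUnit _)

end Dowling

/-! ### Embedding the quaternions and exhibiting zero divisors -/

section Embedding

/-- The square of `ρ 1` is 1, so `1 - ρ 1` kills `1 + ρ 1`; as a difference of distinct elements it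
is a unit. -/
theorem IsQuaternionFamily.map_one {R : Type*} [Ring R] {ρ : Fin 8 → R}
    (h : IsQuaternionFamily ρ) : ρ 1 = -1 := by
  have h1 : (ρ 0 - ρ 1) * (1 + ρ 1) = 0 := by
    have h2 : ρ 1 * ρ 1 = 1 := (h.map_mul 1 1).trans h.map_zero
    rw [h.map_zero, sub_mul, one_mul, mul_add, h2, mul_one]
    abel
  exact eq_neg_of_add_eq_zero_right ((h.isUnit_sub 0 1 (by decide)).mul_right_eq_zero.1 h1)

/-- The quaternion basis given by a copy of the quaternion group in a `K`-algebra. -/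
def IsQuaternionFamily.basis {K R : Type*} [CommRing K] [Ring R] [Algebra K R] {ρ : Fin 8 → R}
    (h : IsQuaternionFamily ρ) : QuaternionAlgebra.Basis R (-1 : K) 0 (-1) where
  i := ρ 2
  j := ρ 4
  k := ρ 6
  i_mul_i := by simpa using (h.map_mul 2 2).trans h.map_one
  j_mul_j := by simpa using (h.map_mul 4 4).trans h.map_one
  i_mul_j := h.map_mul 2 4
  j_mul_i := by
    have h1 : ρ 4 * ρ 2 = ρ 7 := h.map_mul 4 2
    have h2 : ρ 1 * ρ 6 = ρ 7 := h.map_mul 1 6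
    rw [h1, ← h2, h.map_one]
    simp

/-- A ring homomorphism from the quaternions over a field of odd characteristic or characteristic
zero to a nonzero ring is injective. -/
theorem injective_of_quaternion {K R : Type*} [Field K] [Ring R] [Nontrivial R]
    (h2 : (2 : K) ≠ 0) (f : ℍ[K] →+* R) : Injective f := by
  have hre : ∀ q, f q = 0 → q.re = 0 := by
    intro q hq
    have h4 : (4 : K) ≠ 0 := by
      have := mul_ne_zero h2 h2
      norm_num at this
      exact this
    -- The identity q - iqi - jqj - kqk = 4 re q puts a scalar in the two-sided ideal of `q`.
    -- Applied to q, iq, jq and kq, it recovers all four coordinates.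
    have hq4 : q - quaternionGroupEltOf K 2 * q * quaternionGroupEltOf K 2 -
        quaternionGroupEltOf K 4 * q * quaternionGroupEltOf K 4 -
        quaternionGroupEltOf K 6 * q * quaternionGroupEltOf K 6 =
          ((4 * q.re : K) : ℍ[K]) := by
      ext <;>
        simp only [Quaternion.re_sub, Quaternion.imI_sub, Quaternion.imJ_sub, Quaternion.imK_sub,
          Quaternion.re_mul, Quaternion.imI_mul, Quaternion.imJ_mul, Quaternion.imK_mul] <;>
        simp [quaternionGroupEltOf, quaternionGroupCoord]
      ring
    by_contra h0
    have hu : IsUnit (f ((4 * q.re : K) : ℍ[K])) :=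
      ((IsUnit.mk0 _ (mul_ne_zero h4 h0)).map (algebraMap K ℍ[K])).map f
    rw [← hq4] at hu
    simp only [map_sub, map_mul, hq, mul_zero, zero_mul, sub_zero, not_isUnit_zero] at hu
  refine (injective_iff_map_eq_zero f).2 fun q hq => ?_
  have hi := hre (quaternionGroupEltOf K 2 * q) (by rw [map_mul, hq, mul_zero])
  have hj := hre (quaternionGroupEltOf K 4 * q) (by rw [map_mul, hq, mul_zero])
  have hk := hre (quaternionGroupEltOf K 6 * q) (by rw [map_mul, hq, mul_zero])
  rw [Quaternion.re_mul] at hi hj hk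
  ext
  · exact hre q hq
  · simpa [quaternionGroupEltOf, quaternionGroupCoord] using hi
  · simpa [quaternionGroupEltOf, quaternionGroupCoord] using hj
  · simpa [quaternionGroupEltOf, quaternionGroupCoord] using hk

theorem exists_injective_of_isRepresentable {R : Type*} [Ring R] {P : SkewPartialField R}
    (h : IsRepresentable P (R9.sum Q3)) :
    ∃ f : QuaternionsMod3 →+* R, Injective f := by
  have h3 := three_eq_zero_of_isRepresentable_R9 h.of_sum_left
  obtain ⟨ρ, hρ⟩ := exists_isQuaternionFamily_of_isRepresentable_Q3 h.of_sum_right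
  have hR := nontrivial_of_isRepresentable_R9 h.of_sum_left
  have : CharP R 3 := (CharP.charP_iff_prime_eq_zero Nat.prime_three).2 (by exact_mod_cast h3)
  let : Algebra (ZMod 3) R := ZMod.algebra R 3
  exact ⟨(hρ.basis (K := ZMod 3)).liftHom.toRingHom,
    injective_of_quaternion (by decide) _⟩

theorem exists_zero_divisors : ∃ x y : QuaternionsMod3, x ≠ 0 ∧ y ≠ 0 ∧ x * y = 0 := by
  let g := quaternionGroupEltOf (ZMod 3)
  -- (1 + i + j)(1 - i - j) = 1 - (i + j)² = 3, since (i + j)² = -2.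
  refine ⟨g 0 + g 2 + g 4, g 0 - g 2 - g 4, fun h => ?_, fun h => ?_, ?_⟩
  · exact absurd (congrArg QuaternionAlgebra.re h) (by decide)
  · exact absurd (congrArg QuaternionAlgebra.re h) (by decide)
  · ext <;> decide

end Embedding

end ChainGroup

theorem mainTheorem4 :
    -- representable over the skew partial field `(R_3, R_3^*)`
    ChainGroup.IsRepresentable (SkewPartialField.allUnits QuaternionsMod3)
        (ChainGroup.R9.sum ChainGroup.Q3) ∧
    -- not representable over any skew field
    (∀ (D : Type*) [DivisionRing D], ¬ ChainGroup.IsRepresentable (SkewPartialField.allUnits D)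
        (ChainGroup.R9.sum ChainGroup.Q3)) ∧
    -- every ring that represents the matroid contains `R_3` as a subring
    (∀ (R : Type*) [Ring R] (P : SkewPartialField R),
        ChainGroup.IsRepresentable P (ChainGroup.R9.sum ChainGroup.Q3) →
          ∃ f : QuaternionsMod3 →+* R, Function.Injective f) ∧
    -- `R_3` has zero divisors
    (∃ x y : QuaternionsMod3, x ≠ 0 ∧ y ≠ 0 ∧ x * y = 0) := by
  refine ⟨?_, fun D _ h => ?_, fun R _ P h => ChainGroup.exists_injective_of_isRepresentable h,
    ChainGroup.exists_zero_divisors⟩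
  · exact ChainGroup.IsRepresentable.sum
      (ChainGroup.isRepresentable_matrixMatroid_algebra ChainGroup.reidMatrix)
      (ChainGroup.isRepresentable_Q3_quaternion (IsUnit.mk0 _ (by decide)))
  · obtain ⟨f, hf⟩ := ChainGroup.exists_injective_of_isRepresentable h
    obtain ⟨x, y, hx, hy, hxy⟩ := ChainGroup.exists_zero_divisors
    have h0 : f x * f y = 0 := by rw [← map_mul, hxy, map_zero]
    rcases mul_eq_zero.1 h0 with h1 | h1
    · exact hx ((map_eq_zero_iff f hf).1 h1)
    · exact hy ((map_eq_zero_iff f hf).1 h1)
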